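/- Let $d\ge 2$, $n=d+2$, $0<\alpha<n$, $1<q\le n/\alpha$ and $q'=q/(q-1)$. A *time-backward parabolic rectangle* with sidelength $\ell_R=\ell>0$ is a set $R=Q\times[t-\ell^2,t)\subset\mathbb R^d\times\mathbb R=\mathbb R^{d+1}$, where $Q$ is a (half-open) cube with sides parallel to the axes and sidelength $\ell$; put $\delta_3R=3Q\times(t-9\ell^2,t+9\ell^2)$, with $3Q$ the open cube concentric with $Q$ of sidelength $3\ell$. Let $\mathfrak D(R)$ be the family of all rectangles obtained, for $j=0,1,2,\dots$, by cutting each spatial edge of $R$ into $2^j$ and its time edge into $4^j$ equal parts. Let $S\subset\mathbb R^{d+1}$ (for instance $S=\mathbb R^{d+1}$ or $S=\mathbb R^d\times(0,\infty)$) and let $\mathscr D$ be a *parabolic dyadic lattice in $S$*, that is, a collection of time-backward parabolic rectangles such that (i) $R\in\mathscr D$ implies $\mathfrak D(R)\subset\mathscr D$; (ii) for all $R',R''\in\mathscr D$ there is $R\in\mathscr D$ with $R',R''\in\mathfrak D(R)$; (iii) every compact subset of $S$ is contained in some $R\in\mathscr D$. For each $R\in\mathscr D$ let $\eta_R\in C_c^\infty(\mathbb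 R^{d+1})$ with $\mathbf 1_R\le\eta_R\le\mathbf 1_{\delta_3R}$. For a positive Radon measure $\mu$ on $\mathbb R^{d+1}$ put $\mu(\eta_R)=\int\eta_R\,d\mu$, $$\mathcal W^{\mathcal D}_{\alpha,q}\mu(z)=\sum_{R\in\mathscr D,\ \ell_R<1}\bigl(\ell_R^{\alpha q-n}\mu(\eta_R)\bigr)^{q'-1}\eta_R(z),\qquad \mathcal E\mu=\int_{\mathbb R^{d+1}}\mathcal W^{\mathcal D}_{\alpha,q}\mu\,d\mu ,$$ and for compact $K\subset\mathbb R^{d+1}$ $$\mathscr C_{\alpha,q}(K)^{1/q}=\sup\bigl\{\gamma(\mathbb R^{d+1}) : \gamma \text{ a positive Radon measure},\ \gamma(K^c)=0,\ \mathcal E\gamma\le1\bigr\}.$$ **Proposition.** There is a constant $c>0$, depending only on $d,\alpha,q$, such that for all such $S$, $\mathscr D$ and $(\eta_R)$, every finite positive Borel measure $\mu$ on $\mathbb R^{d+1}$, every $\vartheta>0$ and every compact $K\subset S$ with $K\subset\{z:\mathcal W^{\mathcal D}_{\alpha,q}\mu(z)>\vartheta\}$, $$\mathscr C_{\alpha,q}(K)\le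 c\,\vartheta^{1-q}\mu(\mathbb R^{d+1}).$$ (No finiteness of $\mathcal E\mu$ is assumed.) -/

import Mathlib

open MeasureTheory
open scoped ENNReal ContDiff

/-- Space-time `ℝ^{d+1} = ℝ^d × ℝ`. It carries Mathlib's product topology, Borel sets and
differentiable structure; its homogeneous dimension is `n = d + 2`. -/
abbrev SpaceTime (d : ℕ) : Type := EuclideanSpace ℝ (Fin d) × ℝ

/-- A time-backward parabolic rectangle `Q(x, ℓ) × [t - ℓ², t)` (time-lag `1`), recorded by the
centre `x` of the spatial cube, the top time `t`, and the sidelength `ℓ > 0`. -/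
structure BackwardRect (d : ℕ) where
  center : EuclideanSpace ℝ (Fin d)
  time : ℝ
  side : ℝ
  side_pos : 0 < side

namespace BackwardRect

variable {d : ℕ}

/-- The underlying point set. Half-open faces, so that the dyadic rectangles of one generation
tile exactly. -/
def toSet (R : BackwardRect d) : Set (SpaceTime d) :=
  {z | (∀ i, R.center i - R.side / 2 ≤ z.1 i ∧ z.1 i < R.center i + R.side / 2) ∧
    R.time - R.side ^ 2 ≤ z.2 ∧ z.2 < R.time}

/-- The parabolic dilation `δ_lam R = lam Q × (t - lam² ℓ², t + lam² ℓ²)`, an open set. -/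
def dilate (lam : ℝ) (R : BackwardRect d) : Set (SpaceTime d) :=
  {z | (∀ i, |z.1 i - R.center i| < lam * R.side / 2) ∧ |z.2 - R.time| < lam ^ 2 * R.side ^ 2}

/-- `R.IsDyadicSub R₀` says that `R ∈ 𝔇(R₀)`: for some generation `j ≥ 0`, `R` is one of the
`2^{j(d+2)}` rectangles of sidelength `2^{-j} ℓ(R₀)` obtained by cutting every spatial edge of `R₀`
into `2^j` equal parts and its time edge into `4^j` equal parts. -/
def IsDyadicSub (R R₀ : BackwardRect d) : Prop :=
  ∃ j : ℕ, R.side = R₀.side / 2 ^ j ∧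
    (∃ k : Fin d → ℕ, (∀ i, k i < 2 ^ j) ∧
      ∀ i, R.center i - R.side / 2 = R₀.center i - R₀.side / 2 + k i * R.side) ∧
    ∃ m : ℕ, m < 4 ^ j ∧ R.time = R₀.time - m * R.side ^ 2

end BackwardRect

/-- A parabolic dyadic lattice in the region `S` of space-time, in the sense of Lerner and
Nazarov. `S = Set.univ` is a lattice in `ℝ^{d+1}`, `S = {z | 0 < z.2}` one in the upper
half-space. -/
structure IsParabolicDyadicLattice {d : ℕ} (S : Set (SpaceTime d))
    (D : Set (BackwardRect d)) : Prop where
  descendants : ∀ R₀ ∈ D, ∀ R : BackwardRect d, R.IsDyadicSub R₀ → R ∈ D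
  common_ancestor : ∀ R₁ ∈ D, ∀ R₂ ∈ D, ∃ R ∈ D, R₁.IsDyadicSub R ∧ R₂.IsDyadicSub R
  exhaust : ∀ K : Set (SpaceTime d), IsCompact K → K ⊆ S → ∃ R ∈ D, K ⊆ R.toSet

/-- A family of smooth cut-offs `η_R ∈ C_c^∞(ℝ^{d+1})` with `1_R ≤ η_R ≤ 1_{δ₃ R}`, `R ∈ D`. -/
structure IsCutoffFamily {d : ℕ} (D : Set (BackwardRect d))
    (η : BackwardRect d → SpaceTime d → ℝ) : Prop where
  smooth : ∀ R ∈ D, ContDiff ℝ ∞ (η R)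
  compact_support : ∀ R ∈ D, HasCompactSupport (η R)
  lower : ∀ R ∈ D, ∀ z, R.toSet.indicator (fun _ => (1 : ℝ)) z ≤ η R z
  upper : ∀ R ∈ D, ∀ z, η R z ≤ (R.dilate 3).indicator (fun _ => (1 : ℝ)) z

noncomputable section

/-- The regularized dyadic Wolff potential
`∑_{R ∈ D, ℓ_R < 1} (ℓ_R^{αq - n} μ(η_R))^{q' - 1} η_R(z)`, with `n = d + 2` and
`q' = q / (q - 1)`, as a value in `[0, ∞]`. -/
def dyadicWolff {d : ℕ} (D : Set (BackwardRect d)) (η : BackwardRect d → SpaceTime d → ℝ)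
    (α q : ℝ) (μ : Measure (SpaceTime d)) (z : SpaceTime d) : ℝ≥0∞ :=
  ∑' R : {R : BackwardRect d // R ∈ D ∧ R.side < 1},
    (ENNReal.ofReal (R.1.side ^ (α * q - ((d : ℝ) + 2))) *
        ∫⁻ w, ENNReal.ofReal (η R.1 w) ∂μ) ^ (q / (q - 1) - 1) *
      ENNReal.ofReal (η R.1 z)

/-- The regularized dyadic nonlinear energy: the integral of the potential of `μ` against `μ`. -/
def dyadicEnergy {d : ℕ} (D : Set (BackwardRect d)) (η : BackwardRect d → SpaceTime d → ℝ)
    (α q : ℝ) (μ : Measure (SpaceTime d)) : ℝ≥0∞ :=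
  ∫⁻ z, dyadicWolff D η α q μ z ∂μ

/-- The parabolic dyadic Bessel capacity of a (compact) set `K`: the `q`-th power of the supremum
of the total masses of the positive Radon measures `γ` that are concentrated on `K` and have energy
at most `1`. (On `ℝ^{d+1}` the Radon measures are the locally finite Borel measures.) -/
def dyadicCapacity {d : ℕ} (D : Set (BackwardRect d)) (η : BackwardRect d → SpaceTime d → ℝ)
    (α q : ℝ) (K : Set (SpaceTime d)) : ℝ≥0∞ :=
  (sSup {m : ℝ≥0∞ | ∃ γ : Measure (SpaceTime d), IsLocallyFiniteMeasure γ ∧ γ Kᶜ = 0 ∧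
    dyadicEnergy D η α q γ ≤ 1 ∧ m = γ Set.univ}) ^ q

end

/-! Let `γ` be admissible for `K`, of mass `m`. It suffices to bound `m ^ q`, by comparing `μ` with
`γ` through the maximal function `sup μ(δ₃R) / γ(δ₁₅R)` over the `R` with `z ∈ δ₃R`. Replacing
cut-offs by dilates `δ₁₅R` keeps the energy of `γ` at most a constant `A` (`tsum_dilate_le`,
`lintegral_dilatedWolff_le`). By Chebyshev, the dilated potential of `γ` is below `T = 2A/m` on a
set `E ⊆ K` with `γ E ≥ m/2`. At a point of `E` where all ratios are at most `L`, the potential of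
`μ` is at most `L^(q'-1) T` (`dyadicWolff_le_dilatedWolff`). With `L` chosen so that this equals
`θ`, the superlevel condition is contradicted, so the ratio exceeds `L` somewhere at every point of
`E`. A Vitali covering (`mul_measure_le_of_forall_exists`) gives `L γ(E) ≤ μ(ℝ^{d+1})`, which is the
estimate. The energy of `μ` never enters. -/

namespace BackwardRect

/-! ### Geometry of parabolic rectangles -/

variable {d : ℕ}

theorem eq_of_center_time_side {R R' : BackwardRect d} (hc : ∀ i, R.center i = R'.center i)
    (ht : R.time = R'.time) (hs : R.side = R'.side) : R = R' := by
  cases R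
  cases R'
  obtain rfl : _ = _ := PiLp.ext hc
  simp_all

theorem measurableSet_toSet (R : BackwardRect d) : MeasurableSet R.toSet := by
  unfold toSet
  simp only [Set.ofPred_and, Set.ofPred_forall]
  refine (MeasurableSet.iInter fun i => MeasurableSet.inter ?_ ?_).inter
    (MeasurableSet.inter ?_ ?_)
  · exact measurableSet_le (by fun_prop) (by fun_prop)
  · exact measurableSet_lt (by fun_prop) (by fun_prop)
  · exact measurableSet_le (by fun_prop) (by fun_prop)
  · exact measurableSet_lt (by fun_prop) (by fun_prop)

theorem isOpen_dilate (lam : ℝ) (R : BackwardRect d) : IsOpen (R.dilate lam) := by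
  unfold dilate
  simp only [Set.ofPred_and, Set.ofPred_forall]
  refine (isOpen_iInter_of_finite fun i => ?_).inter ?_
  · exact isOpen_lt (by fun_prop) (by fun_prop)
  · exact isOpen_lt (by fun_prop) (by fun_prop)

theorem dilate_mono {lam lam' : ℝ} (h0 : 0 ≤ lam) (h : lam ≤ lam') (R : BackwardRect d) :
    R.dilate lam ⊆ R.dilate lam' := by
  have := R.side_pos
  rintro z ⟨h1, h2⟩
  refine ⟨fun i => (h1 i).trans_le (by gcongr), h2.trans_le (by gcongr)⟩

/-- A dilated rectangle lies in a larger dilate of any rectangle of at least half its side whose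
own dilate it meets. -/
theorem dilate_subset_of_inter_nonempty {R R' : BackwardRect d} (hs : R.side ≤ 2 * R'.side)
    (h : (R.dilate 3 ∩ R'.dilate 3).Nonempty) : R.dilate 3 ⊆ R'.dilate 15 := by
  obtain ⟨y, ⟨hy1, hy2⟩, hy3, hy4⟩ := h
  rintro z ⟨hz1, hz2⟩
  have h0 := R.side_pos
  have h0' := R'.side_pos
  refine ⟨fun i => ?_, ?_⟩
  -- In space `3ℓ + 3ℓ'/2 ≤ 15ℓ'/2` exactly; in time `18ℓ² + 9ℓ'² ≤ 81ℓ'²`, well below `225ℓ'²`.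
  · have a := abs_lt.1 (hy1 i)
    have b := abs_lt.1 (hy3 i)
    have c := abs_lt.1 (hz1 i)
    rw [abs_lt]
    constructor <;> linarith
  · have hsq : R.side ^ 2 ≤ 4 * R'.side ^ 2 := by nlinarith
    have hpos : 0 < R'.side ^ 2 := by positivity
    have a := abs_lt.1 hy2
    have b := abs_lt.1 hy4
    have c := abs_lt.1 hz2
    rw [abs_lt]
    constructor <;> linarith

/-- The translate of `R` by an integer vector in units of its own edges. -/
def shift (v : (Fin d → ℤ) × ℤ) (R : BackwardRect d) : BackwardRect d where
  center := WithLp.toLp 2 fun i => R.center i + v.1 i * R.side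
  time := R.time + v.2 * R.side ^ 2
  side := R.side
  side_pos := R.side_pos

theorem shift_injective (v : (Fin d → ℤ) × ℤ) :
    Function.Injective (shift v : BackwardRect d → BackwardRect d) := by
  intro R R' h
  have hs : (shift v R).side = (shift v R').side := congrArg side h
  change R.side = R'.side at hs
  have ht : (shift v R).time = (shift v R').time := congrArg time h
  change R.time + v.2 * R.side ^ 2 = R'.time + v.2 * R'.side ^ 2 at ht
  refine eq_of_center_time_side (fun i => ?_) (by rw [hs] at ht; linarith) hs
  have hc : (shift v R).center i = (shift v R').center i :=
    congrArg (fun S : BackwardRect d => S.center i) h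
  change R.center i + v.1 i * R.side = R'.center i + v.1 i * R'.side at hc
  rw [hs] at hc
  linarith

theorem IsDyadicSub.toSet_subset {R R₀ : BackwardRect d} (h : R.IsDyadicSub R₀) :
    R.toSet ⊆ R₀.toSet := by
  obtain ⟨j, hs, ⟨k, hk, hc⟩, m, hm, ht⟩ := h
  have h0 := R.side_pos
  have hs' : R₀.side = 2 ^ j * R.side := by rw [hs]; field_simp
  have hsq : R₀.side ^ 2 = 4 ^ j * R.side ^ 2 := by
    rw [hs', mul_pow, ← pow_mul, mul_comm j 2, pow_mul]; norm_num
  rintro z ⟨h1, h2, h3⟩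
  refine ⟨fun i => ?_, ?_, ?_⟩
  · have hk1 : (k i : ℝ) + 1 ≤ 2 ^ j := by exact_mod_cast hk i
    have hk2 := mul_le_mul_of_nonneg_right hk1 h0.le
    have hk0 : (0 : ℝ) ≤ k i * R.side := by positivity
    have := h1 i
    have := hc i
    constructor <;> linarith
  · have hm1 : (m : ℝ) + 1 ≤ 4 ^ j := by exact_mod_cast hm
    have := mul_le_mul_of_nonneg_right hm1 (sq_nonneg R.side)
    linarith
  · have : (0 : ℝ) ≤ m * R.side ^ 2 := by positivity
    linarith

/-- Every generation of descendants of `R₀` covers `R₀`. -/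
theorem exists_isDyadicSub_mem {R₀ : BackwardRect d} {z : SpaceTime d} (hz : z ∈ R₀.toSet)
    (j : ℕ) : ∃ P : BackwardRect d, z ∈ P.toSet ∧ P.side = R₀.side / 2 ^ j ∧ P.IsDyadicSub R₀ ∧
      (∃ k : Fin d → ℕ, ∀ i, P.center i - P.side / 2 = R₀.center i - R₀.side / 2 + k i * P.side) ∧
      ∃ m : ℕ, P.time = R₀.time - m * P.side ^ 2 := by
  have h0 := R₀.side_pos
  obtain ⟨l, hl⟩ : ∃ l, l = R₀.side / 2 ^ j := ⟨_, rfl⟩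
  have hl0 : 0 < l := by rw [hl]; positivity
  have hs' : R₀.side = 2 ^ j * l := by rw [hl]; field_simp
  have hsq : R₀.side ^ 2 = 4 ^ j * l ^ 2 := by
    rw [hs', mul_pow, ← pow_mul, mul_comm j 2, pow_mul]; norm_num
  obtain ⟨h1, h2, h3⟩ := hz
  have hk : ∀ i, ∃ k : ℕ, k < 2 ^ j ∧ R₀.center i - R₀.side / 2 + k * l ≤ z.1 i ∧
      z.1 i < R₀.center i - R₀.side / 2 + (k + 1) * l := by
    intro i
    have hx : 0 ≤ (z.1 i - (R₀.center i - R₀.side / 2)) / l :=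
      div_nonneg (by linarith [(h1 i).1]) hl0.le
    refine ⟨⌊(z.1 i - (R₀.center i - R₀.side / 2)) / l⌋₊, ?_, ?_, ?_⟩
    · rw [Nat.floor_lt hx, div_lt_iff₀ hl0]
      push_cast
      linarith [(h1 i).2]
    · have := Nat.floor_le hx
      rw [le_div_iff₀ hl0] at this
      linarith
    · have := Nat.lt_floor_add_one ((z.1 i - (R₀.center i - R₀.side / 2)) / l)
      rw [div_lt_iff₀ hl0] at this
      linarith
  choose k hk1 hk2 hk3 using hk
  have hm : ∃ m : ℕ, m < 4 ^ j ∧ R₀.time - (m + 1) * l ^ 2 ≤ z.2 ∧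
      z.2 < R₀.time - m * l ^ 2 := by
    have hx : 0 < (R₀.time - z.2) / l ^ 2 := div_pos (by linarith) (by positivity)
    -- Slabs are counted downwards from the top time and are closed at the bottom, so the index is
    -- the ceiling minus one, not the floor.
    obtain ⟨m, hm⟩ : ∃ m, ⌈(R₀.time - z.2) / l ^ 2⌉₊ = m + 1 :=
      Nat.exists_eq_succ_of_ne_zero (Nat.ceil_pos.2 hx).ne'
    refine ⟨m, ?_, ?_, ?_⟩
    · have : ⌈(R₀.time - z.2) / l ^ 2⌉₊ ≤ 4 ^ j := by
        rw [Nat.ceil_le, div_le_iff₀ (by positivity)]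
        push_cast
        linarith
      omega
    · have := Nat.le_ceil ((R₀.time - z.2) / l ^ 2)
      rw [hm, div_le_iff₀ (by positivity)] at this
      push_cast at this
      linarith
    · have := Nat.lt_ceil.1 (show m < ⌈(R₀.time - z.2) / l ^ 2⌉₊ by omega)
      rw [lt_div_iff₀ (by positivity)] at this
      linarith
  obtain ⟨m, hm1, hm2, hm3⟩ := hm
  have hcen : ∀ i, (R₀.center i - R₀.side / 2 + k i * l + l / 2) - l / 2 =
      R₀.center i - R₀.side / 2 + k i * l := fun i => by ring
  refine ⟨⟨WithLp.toLp 2 fun i => R₀.center i - R₀.side / 2 + k i * l + l / 2,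
    R₀.time - m * l ^ 2, l, hl0⟩, ⟨fun i => ⟨?_, ?_⟩, ?_, hm3⟩, hl,
    ⟨j, hl, ⟨k, hk1, hcen⟩, m, hm1, rfl⟩, ⟨k, hcen⟩, m, rfl⟩
  · have := hk2 i
    simp only
    linarith
  · have := hk3 i
    simp only
    linarith
  · simp only
    linarith

end BackwardRect

/-! ### Countability and neighbours in a lattice -/

namespace IsParabolicDyadicLattice

variable {d : ℕ} {S : Set (SpaceTime d)} {D : Set (BackwardRect d)}

/-- Each member shares an ancestor with a fixed `R₀`. Ancestors of `R₀`, and descendants of any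
rectangle, are determined by finitely many integers. -/
theorem countable (hD : IsParabolicDyadicLattice S D) : D.Countable := by
  rcases D.eq_empty_or_nonempty with rfl | ⟨R₀, hR₀⟩
  · exact Set.countable_empty
  have hdesc : ∀ R₁ : BackwardRect d, {R : BackwardRect d | R.IsDyadicSub R₁}.Countable := by
    intro R₁
    refine (Set.countable_range fun p : ℕ × (Fin d → ℕ) × ℕ =>
      (⟨WithLp.toLp 2 fun i => R₁.center i - R₁.side / 2 + p.2.1 i * (R₁.side / 2 ^ p.1) +
        R₁.side / 2 ^ p.1 / 2, R₁.time - p.2.2 * (R₁.side / 2 ^ p.1) ^ 2, R₁.side / 2 ^ p.1,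
        div_pos R₁.side_pos (by positivity)⟩ : BackwardRect d)).mono ?_
    rintro R ⟨j, hs, ⟨k, -, hc⟩, m, -, ht⟩
    refine ⟨(j, k, m), BackwardRect.eq_of_center_time_side (fun i => ?_) ?_ hs.symm⟩
    · have := hc i
      simp only [← hs]
      linarith
    · simp only [← hs, ht]
  have hanc : {R₁ : BackwardRect d | R₀.IsDyadicSub R₁}.Countable := by
    refine (Set.countable_range fun p : ℕ × (Fin d → ℕ) × ℕ =>
      (⟨WithLp.toLp 2 fun i => R₀.center i - R₀.side / 2 + 2 ^ p.1 * R₀.side / 2 -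
        p.2.1 i * R₀.side, R₀.time + p.2.2 * R₀.side ^ 2, 2 ^ p.1 * R₀.side,
        mul_pos (by positivity) R₀.side_pos⟩ : BackwardRect d)).mono ?_
    rintro R ⟨j, hs, ⟨k, -, hc⟩, m, -, ht⟩
    have hs' : R.side = 2 ^ j * R₀.side := by rw [hs]; field_simp
    refine ⟨(j, k, m), BackwardRect.eq_of_center_time_side (fun i => ?_) ?_ hs'.symm⟩
    · have := hc i
      simp only [← hs']
      linarith
    · simp only [ht]
      ring
  refine (hanc.biUnion fun R₁ _ => hdesc R₁).mono fun R hR => ?_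
  obtain ⟨R₁, -, h1, h2⟩ := hD.common_ancestor R hR R₀ hR₀
  exact Set.mem_biUnion (x := R₁) h2 h1

/-- The integer vectors joining a rectangle to those of the same grid that meet its dilate by
`15`. -/
noncomputable def neighbourShifts (d : ℕ) : Finset ((Fin d → ℤ) × ℤ) :=
  Fintype.piFinset (fun _ => Finset.Icc (-8) 8) ×ˢ Finset.Icc (-226) 226

theorem card_neighbourShifts_pos (d : ℕ) : 0 < (neighbourShifts d).card := by
  refine Finset.card_pos.2 ⟨(0, 0), ?_⟩
  simp [neighbourShifts]

/-- A common ancestor of `R` and `R₀` contains `z`, and its descendant through `z` of the generation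
of `R` lies on the same grid as `R`. The condition `z ∈ R₀` is needed because a neighbour of `R` may
fall outside the lattice, as in a half-space. -/
theorem exists_shift_mem (hD : IsParabolicDyadicLattice S D) {R R₀ : BackwardRect d} (hR : R ∈ D)
    (hR₀ : R₀ ∈ D) {z : SpaceTime d} (hz₀ : z ∈ R₀.toSet) (hz : z ∈ R.dilate 15) :
    ∃ v ∈ neighbourShifts d, R.shift v ∈ D ∧ z ∈ (R.shift v).toSet := by
  obtain ⟨R₁, hR₁, ⟨j, hs, ⟨k, -, hc⟩, m, -, ht⟩, h0⟩ := hD.common_ancestor R hR R₀ hR₀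
  obtain ⟨P, hzP, hsP, hP, ⟨k', hc'⟩, m', ht'⟩ :=
    BackwardRect.exists_isDyadicSub_mem (h0.toSet_subset hz₀) j
  have hss : P.side = R.side := hsP.trans hs.symm
  have hl := R.side_pos
  have hl2 : 0 < R.side ^ 2 := by positivity
  rw [hss] at ht' hc'
  have hPR : R.shift (fun i => (k' i : ℤ) - k i, (m : ℤ) - m') = P := by
    refine BackwardRect.eq_of_center_time_side (fun i => ?_) ?_ hss.symm
    · have := hc i
      have := hc' i
      simp only [BackwardRect.shift]
      push_cast
      linarith
    · simp only [BackwardRect.shift]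
      push_cast
      linarith
  refine ⟨_, ?_, hPR ▸ hD.descendants R₁ hR₁ P hP, hPR ▸ hzP⟩
  obtain ⟨h1, h2, h3⟩ := hzP
  obtain ⟨h4, h5⟩ := hz
  rw [hss] at h1 h2
  simp only [neighbourShifts, Finset.mem_product, Fintype.mem_piFinset, Finset.mem_Icc]
  refine ⟨fun i => ?_, ?_⟩
  · have a := abs_lt.1 (h4 i)
    have b := h1 i
    have e := hc i
    have e' := hc' i
    -- `8 = 15/2 + 1/2`: half-width of the dilate plus half an edge. In time, `226 = 15² + 1`.
    have e1 : ((k' i : ℝ) - k i) * R.side < (8 + 1) * R.side := by linarith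
    have e2 : (-8 - 1) * R.side < ((k' i : ℝ) - k i) * R.side := by linarith
    have f1 := lt_of_mul_lt_mul_right e1 hl.le
    have f2 := lt_of_mul_lt_mul_right e2 hl.le
    have g1 : (k' i : ℤ) - k i < 8 + 1 := by exact_mod_cast f1
    have g2 : -8 - 1 < (k' i : ℤ) - k i := by exact_mod_cast f2
    omega
  · have a := abs_lt.1 h5
    have e1 : ((m : ℝ) - m') * R.side ^ 2 < (226 + 1) * R.side ^ 2 := by linarith
    have e2 : (-226 - 1) * R.side ^ 2 < ((m : ℝ) - m') * R.side ^ 2 := by linarith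
    have f1 := lt_of_mul_lt_mul_right e1 hl2.le
    have f2 := lt_of_mul_lt_mul_right e2 hl2.le
    have g1 : (m : ℤ) - m' < 226 + 1 := by exact_mod_cast f1
    have g2 : -226 - 1 < (m : ℤ) - m' := by exact_mod_cast f2
    omega

/-! ### Comparison of energies under dilation -/

open Classical in
/-- Enlarging the rectangles increases a dyadic energy by at most a constant factor. -/
theorem tsum_dilate_le (hD : IsParabolicDyadicLattice S D) {γ : Measure (SpaceTime d)}
    {R₀ : BackwardRect d} (hR₀ : R₀ ∈ D) (hγ : γ R₀.toSetᶜ = 0) (κ : ℝ → ℝ≥0∞) {s : ℝ}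
    (hs : 0 ≤ s) :
    ∑' R : {R : BackwardRect d // R ∈ D ∧ R.side < 1},
        (κ R.1.side * γ (R.1.dilate 15)) ^ s * γ (R.1.dilate 15) ≤
      ((neighbourShifts d).card : ℝ≥0∞) ^ (s + 1) *
        ∑' R : {R : BackwardRect d // R ∈ D ∧ R.side < 1},
          (κ R.1.side * γ R.1.toSet) ^ s * γ R.1.toSet := by
  set F := neighbourShifts d
  have hpow : ∀ a x : ℝ≥0∞, (a * x) ^ s * x = a ^ s * x ^ (s + 1) := by
    intro a x
    rw [ENNReal.mul_rpow_of_nonneg _ _ hs, mul_assoc,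
      ENNReal.rpow_add_of_nonneg _ _ hs zero_le_one, ENNReal.rpow_one]
  simp only [hpow]
  -- Extended by zero, since a shift may leave `D`.
  let g : BackwardRect d → ℝ≥0∞ := fun P =>
    if P ∈ D ∧ P.side < 1 then κ P.side ^ s * γ P.toSet ^ (s + 1) else 0
  have hg : ∑' R : {R : BackwardRect d // R ∈ D ∧ R.side < 1},
      κ R.1.side ^ s * γ R.1.toSet ^ (s + 1) = ∑' P, g P := by
    rw [← tsum_subtype_eq_of_support_subset (s := {R : BackwardRect d | R ∈ D ∧ R.side < 1})]
    · refine tsum_congr fun R => ?_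
      exact (if_pos R.2).symm
    · intro P hP
      by_contra h
      exact hP (if_neg h)
  have hone : ∀ R : {R : BackwardRect d // R ∈ D ∧ R.side < 1},
      κ R.1.side ^ s * γ (R.1.dilate 15) ^ (s + 1) ≤
        (F.card : ℝ≥0∞) ^ s * ∑ v ∈ F, g (R.1.shift v) := by
    rintro ⟨R, hR, hR1⟩
    let f : (Fin d → ℤ) × ℤ → ℝ≥0∞ := fun v =>
      if R.shift v ∈ D then γ (R.shift v).toSet else 0
    have hcov : γ (R.dilate 15) ≤ ∑ v ∈ F, f v := by
      calc γ (R.dilate 15)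
          ≤ γ (R₀.toSetᶜ ∪ ⋃ v ∈ F.filter fun v => R.shift v ∈ D, (R.shift v).toSet) := by
            refine measure_mono fun z hz => ?_
            by_cases hz₀ : z ∈ R₀.toSet
            · obtain ⟨v, hv, hvD, hzv⟩ := hD.exists_shift_mem hR hR₀ hz₀ hz
              refine Or.inr (Set.mem_biUnion (x := v) ?_ hzv)
              simp [hvD, F, hv]
            · exact Or.inl hz₀
        _ ≤ γ R₀.toSetᶜ + γ (⋃ v ∈ F.filter fun v => R.shift v ∈ D, (R.shift v).toSet) :=
            measure_union_le _ _
        _ ≤ 0 + ∑ v ∈ F.filter fun v => R.shift v ∈ D, γ (R.shift v).toSet := by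
            rw [hγ]
            gcongr
            exact measure_biUnion_finset_le _ _
        _ = ∑ v ∈ F, f v := by rw [zero_add, Finset.sum_filter]
    calc κ R.side ^ s * γ (R.dilate 15) ^ (s + 1)
        ≤ κ R.side ^ s * ((F.card : ℝ≥0∞) ^ s * ∑ v ∈ F, f v ^ (s + 1)) := by
          gcongr
          refine (ENNReal.rpow_le_rpow hcov (by positivity)).trans ?_
          -- Convexity of `x ^ (s + 1)` costs `card ^ s`; summing over the shifts costs the
          -- remaining factor `card`.
          have := ENNReal.rpow_sum_le_const_mul_sum_rpow F f (p := s + 1) (by linarith)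
          simpa using this
      _ = (F.card : ℝ≥0∞) ^ s * ∑ v ∈ F, κ R.side ^ s * f v ^ (s + 1) := by
          rw [← Finset.mul_sum]; ring
      _ = _ := by
          congr 1
          refine Finset.sum_congr rfl fun v _ => ?_
          have hside : (R.shift v).side = R.side := rfl
          by_cases hv : R.shift v ∈ D
          · simp [f, g, hv, hside, hR1]
          · simp [f, g, hv, ENNReal.zero_rpow_of_pos (show 0 < s + 1 by positivity)]
  rw [hg]
  calc _ ≤ ∑' R : {R : BackwardRect d // R ∈ D ∧ R.side < 1},
        (F.card : ℝ≥0∞) ^ s * ∑ v ∈ F, g (R.1.shift v) := ENNReal.tsum_le_tsum hone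
    _ = (F.card : ℝ≥0∞) ^ s * ∑ v ∈ F,
        ∑' R : {R : BackwardRect d // R ∈ D ∧ R.side < 1}, g (R.1.shift v) := by
      rw [ENNReal.tsum_mul_left, Summable.tsum_finsetSum fun _ _ => ENNReal.summable]
    _ ≤ (F.card : ℝ≥0∞) ^ s * ∑ v ∈ F, ∑' P, g P := by
      gcongr with v
      -- For fixed `v`, each rectangle is reached at most once.
      exact ENNReal.tsum_comp_le_tsum_of_injective
        ((BackwardRect.shift_injective v).comp Subtype.val_injective) g
    _ = _ := by
      rw [Finset.sum_const, nsmul_eq_mul, ← mul_assoc,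
        ENNReal.rpow_add_of_nonneg _ _ hs zero_le_one, ENNReal.rpow_one]

/-! ### Weak type estimate by covering -/

/-- Weak type estimate for the maximal function `sup μ(δ₃ R) / γ(δ₁₅ R)`. -/
theorem mul_measure_le_of_forall_exists (hD : IsParabolicDyadicLattice S D)
    {γ μ : Measure (SpaceTime d)} {E : Set (SpaceTime d)} {L : ℝ≥0∞}
    (hE : ∀ z ∈ E, ∃ R ∈ D, R.side < 1 ∧ z ∈ R.dilate 3 ∧
      L * γ (R.dilate 15) ≤ μ (R.dilate 3)) : L * γ E ≤ μ Set.univ := by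
  let t : Set (BackwardRect d) :=
    {R | R ∈ D ∧ R.side < 1 ∧ L * γ (R.dilate 15) ≤ μ (R.dilate 3)}
  have hne : ∀ R ∈ t, (R.dilate 3).Nonempty := by
    intro R _
    have := R.side_pos
    refine ⟨(R.center, R.time), fun i => ?_, ?_⟩ <;> simp only [sub_self, abs_zero] <;>
      positivity
  -- The bound `R.side < 1` makes the selection possible; the ratio `2` is the one that leads to the
  -- dilate by `15`.
  obtain ⟨u, hut, hdisj, hcov⟩ := Vitali.exists_disjoint_subfamily_covering_enlargement
    (fun R : BackwardRect d => R.dilate 3) t (fun R => R.side) 2 one_lt_two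
    (fun R _ => R.side_pos.le) 1 (fun R hR => hR.2.1.le) hne
  have hu : u.Countable := hD.countable.mono fun R hR => (hut hR).1
  have hEu : E ⊆ ⋃ R ∈ u, R.dilate 15 := by
    intro z hz
    obtain ⟨R, hR, hR1, hzR, hle⟩ := hE z hz
    obtain ⟨R', hR', hint, hss⟩ := hcov R ⟨hR, hR1, hle⟩
    exact Set.mem_biUnion hR' (BackwardRect.dilate_subset_of_inter_nonempty hss hint hzR)
  calc L * γ E ≤ L * ∑' R : u, γ (R.1.dilate 15) := by
        gcongr
        exact (measure_mono hEu).trans (measure_biUnion_le _ hu _)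
    _ = ∑' R : u, L * γ (R.1.dilate 15) := ENNReal.tsum_mul_left.symm
    _ ≤ ∑' R : u, μ (R.1.dilate 3) := ENNReal.tsum_le_tsum fun R => (hut R.2).2.2
    _ = μ (⋃ R ∈ u, R.dilate 3) :=
        (measure_biUnion hu hdisj fun R _ => (R.isOpen_dilate 3).measurableSet).symm
    _ ≤ μ Set.univ := measure_mono (Set.subset_univ _)

end IsParabolicDyadicLattice

/-! ### Comparison of potentials -/

/-- The dyadic Wolff potential with the cut-offs replaced by indicators of dilated rectangles. -/
noncomputable def dilatedWolff {d : ℕ} (D : Set (BackwardRect d)) (α q lam : ℝ)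
    (μ : Measure (SpaceTime d)) (z : SpaceTime d) : ℝ≥0∞ :=
  ∑' R : {R : BackwardRect d // R ∈ D ∧ R.side < 1},
    (ENNReal.ofReal (R.1.side ^ (α * q - ((d : ℝ) + 2))) * μ (R.1.dilate lam)) ^
      (q / (q - 1) - 1) * (R.1.dilate lam).indicator 1 z

section Potential

variable {d : ℕ} {S : Set (SpaceTime d)} {D : Set (BackwardRect d)}
  {η : BackwardRect d → SpaceTime d → ℝ} {α q : ℝ}

theorem IsCutoffFamily.ofReal_le_indicator (hη : IsCutoffFamily D η) {R : BackwardRect d}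
    (hR : R ∈ D) (z : SpaceTime d) :
    ENNReal.ofReal (η R z) ≤ (R.dilate 3).indicator 1 z := by
  have h := hη.upper R hR z
  by_cases hz : z ∈ R.dilate 3
  · simpa [hz] using h
  · simpa [hz] using h

theorem IsCutoffFamily.indicator_le_ofReal (hη : IsCutoffFamily D η) {R : BackwardRect d}
    (hR : R ∈ D) (z : SpaceTime d) :
    R.toSet.indicator 1 z ≤ ENNReal.ofReal (η R z) := by
  have h := hη.lower R hR z
  by_cases hz : z ∈ R.toSet
  · simpa [hz] using h
  · simp [hz]

theorem IsCutoffFamily.lintegral_le (hη : IsCutoffFamily D η) {R : BackwardRect d} (hR : R ∈ D)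
    (μ : Measure (SpaceTime d)) : ∫⁻ w, ENNReal.ofReal (η R w) ∂μ ≤ μ (R.dilate 3) := by
  rw [← lintegral_indicator_one (R.isOpen_dilate 3).measurableSet]
  exact lintegral_mono (hη.ofReal_le_indicator hR)

theorem IsCutoffFamily.measure_toSet_le (hη : IsCutoffFamily D η) {R : BackwardRect d}
    (hR : R ∈ D) (μ : Measure (SpaceTime d)) :
    μ R.toSet ≤ ∫⁻ w, ENNReal.ofReal (η R w) ∂μ := by
  rw [← lintegral_indicator_one R.measurableSet_toSet]
  exact lintegral_mono (hη.indicator_le_ofReal hR)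

theorem measurable_dilatedWolff (hD : IsParabolicDyadicLattice S D) (lam : ℝ)
    (μ : Measure (SpaceTime d)) : Measurable (dilatedWolff D α q lam μ) := by
  have : Countable {R : BackwardRect d // R ∈ D ∧ R.side < 1} :=
    (hD.countable.mono fun R (hR : R ∈ D ∧ R.side < 1) => hR.1).to_subtype
  unfold dilatedWolff
  exact Measurable.tsum fun R =>
    (measurable_one.indicator (R.1.isOpen_dilate lam).measurableSet).const_mul _

theorem tsum_le_dyadicEnergy (hD : IsParabolicDyadicLattice S D) (hη : IsCutoffFamily D η)
    (hq : 0 ≤ q / (q - 1) - 1) (γ : Measure (SpaceTime d)) :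
    ∑' R : {R : BackwardRect d // R ∈ D ∧ R.side < 1},
      (ENNReal.ofReal (R.1.side ^ (α * q - ((d : ℝ) + 2))) * γ R.1.toSet) ^
        (q / (q - 1) - 1) * γ R.1.toSet ≤ dyadicEnergy D η α q γ := by
  have : Countable {R : BackwardRect d // R ∈ D ∧ R.side < 1} :=
    (hD.countable.mono fun R (hR : R ∈ D ∧ R.side < 1) => hR.1).to_subtype
  have hm : ∀ R : {R : BackwardRect d // R ∈ D ∧ R.side < 1},
      Measurable fun z => ENNReal.ofReal (η R.1 z) := fun R =>
    ((hη.smooth R.1 R.2.1).continuous.measurable).ennreal_ofReal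
  unfold dyadicEnergy dyadicWolff
  rw [lintegral_tsum fun R => ((hm R).const_mul _).aemeasurable]
  refine ENNReal.tsum_le_tsum fun R => ?_
  rw [lintegral_const_mul _ (hm R)]
  have h := hη.measure_toSet_le R.2.1 γ
  gcongr

/-- On a measure carried by a rectangle of the lattice, the energy of the dilated potential is
controlled by the regularized dyadic energy. -/
theorem lintegral_dilatedWolff_le (hD : IsParabolicDyadicLattice S D) (hη : IsCutoffFamily D η)
    (hq : 0 ≤ q / (q - 1) - 1) {γ : Measure (SpaceTime d)} {R₀ : BackwardRect d} (hR₀ : R₀ ∈ D)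
    (hγ : γ R₀.toSetᶜ = 0) :
    ∫⁻ z, dilatedWolff D α q 15 γ z ∂γ ≤
      ((IsParabolicDyadicLattice.neighbourShifts d).card : ℝ≥0∞) ^ (q / (q - 1) - 1 + 1) *
        dyadicEnergy D η α q γ := by
  have : Countable {R : BackwardRect d // R ∈ D ∧ R.side < 1} :=
    (hD.countable.mono fun R (hR : R ∈ D ∧ R.side < 1) => hR.1).to_subtype
  have hm : ∀ R : {R : BackwardRect d // R ∈ D ∧ R.side < 1},
      Measurable ((R.1.dilate 15).indicator (1 : SpaceTime d → ℝ≥0∞)) := fun R =>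
    measurable_one.indicator (R.1.isOpen_dilate 15).measurableSet
  unfold dilatedWolff
  rw [lintegral_tsum fun R => ((hm R).const_mul _).aemeasurable]
  simp only [lintegral_const_mul _ (hm _),
    lintegral_indicator_one (BackwardRect.isOpen_dilate 15 _).measurableSet]
  refine (hD.tsum_dilate_le hR₀ hγ
    (fun l => ENNReal.ofReal (l ^ (α * q - ((d : ℝ) + 2)))) hq).trans ?_
  gcongr
  exact tsum_le_dyadicEnergy hD hη hq γ

theorem dyadicWolff_le_dilatedWolff (hη : IsCutoffFamily D η) (hq : 0 ≤ q / (q - 1) - 1)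
    {γ μ : Measure (SpaceTime d)} {z : SpaceTime d} {L : ℝ≥0∞}
    (h : ∀ R ∈ D, R.side < 1 → z ∈ R.dilate 3 → μ (R.dilate 3) ≤ L * γ (R.dilate 15)) :
    dyadicWolff D η α q μ z ≤ L ^ (q / (q - 1) - 1) * dilatedWolff D α q 15 γ z := by
  unfold dyadicWolff dilatedWolff
  rw [← ENNReal.tsum_mul_left]
  refine ENNReal.tsum_le_tsum fun R => ?_
  obtain ⟨R, hR, hR1⟩ := R
  by_cases hz : z ∈ R.dilate 3
  · have hz' := R.dilate_mono (by norm_num) (by norm_num : (3 : ℝ) ≤ 15) hz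
    have h1 : ENNReal.ofReal (η R z) ≤ 1 := by
      simpa [hz] using hη.ofReal_le_indicator hR z
    have h2 := (hη.lintegral_le hR μ).trans (h R hR hR1 hz)
    simp only [Set.indicator_of_mem hz', Pi.one_apply]
    rw [← mul_assoc, ← ENNReal.mul_rpow_of_nonneg _ _ hq]
    gcongr ?_ ^ _ * ?_
    calc _ ≤ ENNReal.ofReal (R.side ^ (α * q - ((d : ℝ) + 2))) * (L * γ (R.dilate 15)) := by
          gcongr
      _ = _ := by ring
  · have h1 : ENNReal.ofReal (η R z) = 0 := by
      simpa [hz] using hη.ofReal_le_indicator hR z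
    simp [h1]

/-! ### Capacity of superlevel sets -/

/-- The mass of an admissible measure for the capacity of a superlevel set. -/
theorem rpow_measure_univ_le (hq : 1 < q) (hD : IsParabolicDyadicLattice S D)
    (hη : IsCutoffFamily D η) {γ μ : Measure (SpaceTime d)} {R₀ : BackwardRect d} (hR₀ : R₀ ∈ D)
    {K : Set (SpaceTime d)} (hK : K ⊆ R₀.toSet) (hγK : γ Kᶜ = 0) (hγ : γ Set.univ ≠ ⊤)
    (hE : dyadicEnergy D η α q γ ≤ 1) {θ : ℝ} (hθ : 0 < θ)
    (hKθ : K ⊆ {z | ENNReal.ofReal θ < dyadicWolff D η α q μ z}) {A : ℝ} (hA0 : 0 < A)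
    (hA : ((IsParabolicDyadicLattice.neighbourShifts d).card : ℝ≥0∞) ^ (q / (q - 1) - 1 + 1) ≤
      ENNReal.ofReal A) :
    γ Set.univ ^ q ≤ ENNReal.ofReal (2 * (2 * A) ^ (q - 1) * θ ^ (1 - q)) * μ Set.univ := by
  have hq1 : 0 < q - 1 := by linarith
  have hexp : q / (q - 1) - 1 = (q - 1)⁻¹ := by field_simp; ring
  have hs : 0 ≤ q / (q - 1) - 1 := by rw [hexp]; positivity
  rcases eq_or_ne (γ Set.univ) 0 with h0 | h0
  · rw [h0, ENNReal.zero_rpow_of_pos (by linarith)]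
    exact zero_le
  obtain ⟨m, hm0, hm⟩ : ∃ m : ℝ, 0 < m ∧ γ Set.univ = ENNReal.ofReal m :=
    ⟨(γ Set.univ).toReal, ENNReal.toReal_pos h0 hγ, (ENNReal.ofReal_toReal hγ).symm⟩
  -- `T` makes the Chebyshev bound `A / T` equal to `m / 2`; `L` solves `L^(q'-1) T = θ`, where `q'
  -- - 1 = 1/(q - 1)`.
  set T : ℝ := 2 * A / m with hT
  have hT0 : 0 < T := by positivity
  set L : ℝ := (θ / T) ^ (q - 1) with hL
  have hL0 : 0 < L := by positivity
  have hLT : L ^ (q / (q - 1) - 1) * T = θ := by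
    rw [hL, hexp, Real.rpow_rpow_inv (by positivity) hq1.ne']
    field_simp
  have hint : ∫⁻ z, dilatedWolff D α q 15 γ z ∂γ ≤ ENNReal.ofReal A := by
    refine (lintegral_dilatedWolff_le hD hη hs hR₀
      (measure_mono_null (Set.compl_subset_compl.2 hK) hγK)).trans ?_
    calc _ ≤ ENNReal.ofReal A * 1 := mul_le_mul' hA hE
      _ = _ := mul_one _
  have hbad : γ {z | ENNReal.ofReal T ≤ dilatedWolff D α q 15 γ z} ≤ ENNReal.ofReal (m / 2) := by
    have h1 := (mul_meas_ge_le_lintegral (μ := γ) (measurable_dilatedWolff (α := α) (q := q) hD 15 γ)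
      (ENNReal.ofReal T)).trans hint
    rw [mul_comm, ← ENNReal.le_div_iff_mul_le (Or.inl (by simpa using hT0)) (Or.inl (by simp)),
      ← ENNReal.ofReal_div_of_pos hT0] at h1
    refine h1.trans_eq (congrArg _ ?_)
    rw [hT]
    field_simp
  set E : Set (SpaceTime d) := K ∩ {z | dilatedWolff D α q 15 γ z < ENNReal.ofReal T} with hEdef
  have hEm : ENNReal.ofReal (m / 2) ≤ γ E := by
    have h1 : γ Set.univ ≤ γ E + ENNReal.ofReal (m / 2) := by
      calc γ Set.univ
          ≤ γ (Kᶜ ∪ (E ∪ {z | ENNReal.ofReal T ≤ dilatedWolff D α q 15 γ z})) := by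
            refine measure_mono fun z _ => ?_
            by_cases hz : z ∈ K
            · rcases lt_or_ge (dilatedWolff D α q 15 γ z) (ENNReal.ofReal T) with h | h
              · exact Or.inr (Or.inl ⟨hz, h⟩)
              · exact Or.inr (Or.inr h)
            · exact Or.inl hz
        _ ≤ γ Kᶜ + (γ E + γ {z | ENNReal.ofReal T ≤ dilatedWolff D α q 15 γ z}) :=
            (measure_union_le _ _).trans (by gcongr; exact measure_union_le _ _)
        _ ≤ _ := by rw [hγK, zero_add]; gcongr
    rw [hm, ← add_halves m, ENNReal.ofReal_add (by positivity) (by positivity),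
      add_halves] at h1
    exact (ENNReal.add_le_add_iff_right ENNReal.ofReal_ne_top).1 h1
  have hweak : ENNReal.ofReal L * γ E ≤ μ Set.univ := by
    refine hD.mul_measure_le_of_forall_exists fun z hz => ?_
    by_contra! hcon
    have h1 := dyadicWolff_le_dilatedWolff (α := α) hη hs (γ := γ) (μ := μ) (z := z)
      (L := ENNReal.ofReal L) fun R hR hR1 hzR => (hcon R hR hR1 hzR).le
    have h2 : ENNReal.ofReal θ < ENNReal.ofReal θ :=
      calc ENNReal.ofReal θ < dyadicWolff D η α q μ z := hKθ hz.1
        _ ≤ _ := h1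
        _ ≤ ENNReal.ofReal L ^ (q / (q - 1) - 1) * ENNReal.ofReal T := by
          gcongr
          exact hz.2.le
        _ = ENNReal.ofReal θ := by
          rw [ENNReal.ofReal_rpow_of_pos hL0, ← ENNReal.ofReal_mul (by positivity), hLT]
    exact h2.false
  have hmq : m ^ q = 2 * (2 * A) ^ (q - 1) * θ ^ (1 - q) * (L * (m / 2)) := by
    have e1 : m ^ q = m ^ (q - 1) * m := by
      rw [← Real.rpow_add_one hm0.ne']; congr 1; ring
    have e2 : L = θ ^ (q - 1) * m ^ (q - 1) / (2 * A) ^ (q - 1) := by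
      rw [hL, hT, div_div_eq_mul_div, Real.div_rpow (by positivity) (by positivity),
        Real.mul_rpow hθ.le hm0.le]
    have e3 : θ ^ (1 - q) * θ ^ (q - 1) = 1 := by
      rw [← Real.rpow_add hθ]; simp
    have e4 : (2 * A) ^ (q - 1) ≠ 0 := by positivity
    rw [e1, e2]
    field_simp
    linear_combination (-1 : ℝ) * e3
  rw [hm, ENNReal.ofReal_rpow_of_pos hm0, hmq, ENNReal.ofReal_mul (by positivity)]
  gcongr
  rw [ENNReal.ofReal_mul hL0.le]
  refine le_trans ?_ hweak
  gcongr

end Potential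

theorem proposition5p9 (d : ℕ) (hd : 2 ≤ d) (α q : ℝ)
    (hα : 0 < α) (hαn : α < (d : ℝ) + 2) (hq : 1 < q) (hqn : q ≤ ((d : ℝ) + 2) / α) :
    ∃ c : ℝ, 0 < c ∧
      ∀ (S : Set (SpaceTime d)) (D : Set (BackwardRect d)) (_ : IsParabolicDyadicLattice S D)
        (η : BackwardRect d → SpaceTime d → ℝ) (_ : IsCutoffFamily D η)
        (μ : Measure (SpaceTime d)) (_ : IsFiniteMeasure μ)
        (θ : ℝ) (_ : 0 < θ)
        (K : Set (SpaceTime d)) (_ : IsCompact K) (_ : K ⊆ S)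
        (_ : K ⊆ {z | ENNReal.ofReal θ < dyadicWolff D η α q μ z}),
        dyadicCapacity D η α q K ≤ ENNReal.ofReal (c * θ ^ (1 - q)) * μ Set.univ := by
  have hN : (0 : ℝ) < (IsParabolicDyadicLattice.neighbourShifts d).card :=
    Nat.cast_pos.2 (IsParabolicDyadicLattice.card_neighbourShifts_pos d)
  obtain ⟨A, hA⟩ : ∃ A : ℝ, A =
      ((IsParabolicDyadicLattice.neighbourShifts d).card : ℝ) ^ (q / (q - 1) - 1 + 1) := ⟨_, rfl⟩
  have hA0 : 0 < A := by rw [hA]; positivity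
  refine ⟨2 * (2 * A) ^ (q - 1), by positivity, ?_⟩
  intro S D hD η hη μ _ θ hθ K hK hKS hKθ
  obtain ⟨R₀, hR₀, hKR₀⟩ := hD.exhaust K hK hKS
  have hq0 : 0 < q := by linarith
  unfold dyadicCapacity
  rw [← ENNReal.le_rpow_inv_iff hq0]
  refine sSup_le ?_
  rintro _ ⟨γ, _, hγK, hE, rfl⟩
  rw [ENNReal.le_rpow_inv_iff hq0]
  -- A locally finite measure carried by a compact set is finite.
  have hγ : γ Set.univ ≠ ⊤ := by
    have h : γ Set.univ ≤ γ K + γ Kᶜ := by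
      rw [← Set.union_compl_self K]
      exact measure_union_le _ _
    rw [hγK, add_zero] at h
    exact (h.trans_lt hK.measure_lt_top).ne
  refine rpow_measure_univ_le hq hD hη hR₀ hKR₀ hγK hγ hE hθ hKθ hA0 ?_
  rw [hA, ← ENNReal.ofReal_rpow_of_pos hN, ENNReal.ofReal_natCast]
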